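/- A stochastic game $G$ consists of a finite directed graph $(V,E)$ in which every vertex has an out-neighbour, a partition of $V$ into vertices of Player 1, vertices of Player 2 and probabilistic vertices, for each probabilistic vertex a probability distribution whose support is exactly the set of its out-neighbours, and a payoff $w:E\to\mathbb{Q}$. A play is an infinite path; strategies are deterministic maps from finite nonempty paths (prefixes) ending in a vertex of the player to out-neighbours of that vertex. For a window length $\ell\ge 1$, $\mathrm{FWMP}(\ell)$ is the set of plays $v_0v_1\cdots$ such that $\exists k\ \forall i\ge k\ \exists j\in\{1,\dots,\ell\}$: $\frac1j\sum_{t=i}^{i+j-1}w(v_t,v_{t+1})\ge 0$; its complement $\overline{\mathrm{FWMP}(\ell)}$ in the set of plays is the objective of Player 2. Let $G_{\mathrm{NS}}$ be the adversarial non-stochastic game obtained from $G$ by giving all probabilistic vertices to Player 2. In $G_{\mathrm{NS}}$, a strategy of Player 2 wins from $v$ if every play from $v$ consistent with it satisfies his objective; in $G$, a strategy of Player 2 wins almost surely from $v$ if, against every strategy of Player 1, the outcome from $v$ satisfies his objective with probability $1$. A Mealy machine $M=(Q,q_0,\Delta,\delta)$ with $\Delta:Q\times V\to Q$ and $\delta:Q\times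 V\to V\cup\{\epsilon\}$ defines a strategy $\sigma$ of a player if, for every prefix $\rho v$ ending in a vertex $v$ of that player, $\sigma(\rho v)=\delta(\hat\Delta(q_0,\rho),v)$, where $\hat\Delta(q_0,\rho)$ is the state reached from $q_0$ after reading the (possibly empty) word $\rho$. The memory size of $\sigma$ is the least number of states of a Mealy machine defining $\sigma$. If $M$ defines a strategy $\sigma$ of Player 2 in $G_{\mathrm{NS}}$, call $(q,v)\in Q\times V$ reachable if there is a prefix $\rho v$ of $G_{\mathrm{NS}}$ consistent with $\sigma$ such that $\hat\Delta(q_0,\rho)=q$. The reset machine of $M$ has the same states and initial state; on reading $v$ in state $q$ it takes the transition, and if $v$ belongs to Player 2 in $G$ also gives the output, of $M$ at $(q,v)$ if $(q,v)$ is reachable and of $M$ at $(q_0,v)$ otherwise; its output at all other vertices is $\epsilon$. A strategy of Player 2 in $G$ defined by it is called a reset strategy. Lemma. Let $G$ be a stochastic game and $\ell\ge 1$. (1) $\mathrm{FWMP}(\ell)$ is a Borel, prefix-independent objective with the sure-almost-sure (SAS) property: if Player 2 wins $\overline{\mathrm{FWMP}(\ell)}$ from every vertex in $G_{\mathrm{NS}}$,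 then he wins $\overline{\mathrm{FWMP}(\ell)}$ almost surely from every vertex in $G$. (2) If Player 2 wins $\overline{\mathrm{FWMP}(\ell)}$ from every vertex in $G_{\mathrm{NS}}$, then he has a single strategy of finite memory size that wins from every vertex in $G_{\mathrm{NS}}$. (3) Let $\sigma$ be any strategy of Player 2 that wins $\overline{\mathrm{FWMP}(\ell)}$ from every vertex in $G_{\mathrm{NS}}$. For every finite Mealy machine $M$ defining $\sigma$, the reset machine of $M$ defines a strategy of Player 2 in $G$ that wins $\overline{\mathrm{FWMP}(\ell)}$ almost surely from every vertex. If $\sigma$ has finite memory size, then some such reset strategy, for a suitable finite $M$ defining $\sigma$, has memory size at most that of $\sigma$. -/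

import Mathlib

open MeasureTheory ProbabilityTheory

/-- The two players. -/
inductive Player where
  | one
  | two
  deriving DecidableEq

/-- A (turn-based, zero-sum) stochastic game with vertex set `V`. `owner v = some i` means that
the vertex `v` belongs to Player `i`, and `owner v = none` that `v` is probabilistic. Only the
values of `payoff` on edges matter. -/
structure StochasticGame (V : Type*) where
  edge : V → V → Prop
  exists_edge : ∀ v, ∃ v', edge v v'
  owner : V → Option Player
  prob : {v : V // owner v = none} → PMF V
  prob_support : ∀ v v', v' ∈ (prob v).support ↔ edge v.1 v'
  payoff : V → V → ℚ

/-- The finite sequence `π 0, …, π (n - 1)` of the first `n` vertices of `π`. -/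
def history {V : Type*} (π : ℕ → V) (n : ℕ) : List V := List.ofFn fun k : Fin n => π k

/-- A Mealy machine with set of states `Q`, input alphabet `A` and output alphabet `B`. -/
structure MealyMachine (Q A B : Type*) where
  init : Q
  trans : Q → A → Q
  out : Q → A → B

namespace MealyMachine

variable {Q A B : Type*}

/-- The state reached from the initial state after reading a (possibly empty) word. -/
def run (M : MealyMachine Q A B) (w : List A) : Q := w.foldl M.trans M.init

end MealyMachine

namespace StochasticGame

variable {V : Type*}

/-- The non-stochastic game obtained by giving all probabilistic vertices to Player 2. -/
def adversarial (G : StochasticGame V) : StochasticGame V where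
  edge := G.edge
  exists_edge := G.exists_edge
  owner v := some ((G.owner v).getD Player.two)
  prob v := absurd v.2 (by simp)
  prob_support v := absurd v.2 (by simp)
  payoff := G.payoff

/-! ### Plays and objectives -/

/-- The set of plays. -/
def plays (G : StochasticGame V) : Set (ℕ → V) := {π | ∀ i, G.edge (π i) (π (i + 1))}

/-- Finite paths; a prefix is a nonempty one. -/
def IsPath (G : StochasticGame V) (w : List V) : Prop := w.IsChain G.edge

/-- The complement of an objective within the set of plays. -/
def compl (G : StochasticGame V) (O : Set (ℕ → V)) : Set (ℕ → V) := G.plays \ O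

/-- Closed under suffixes, and closed under prepending finite prefixes as long as the result is
a play. -/
def PrefixIndependent (G : StochasticGame V) (O : Set (ℕ → V)) : Prop :=
  (∀ π ∈ O, ∀ j, (fun k => π (j + k)) ∈ O) ∧
    (∀ π ∈ G.plays, ∀ j, (fun k => π (j + k)) ∈ O → π ∈ O)

/-- The mean payoff of the infix `π i, …, π (i + n)`. -/
def meanPayoff (G : StochasticGame V) (π : ℕ → V) (i n : ℕ) : ℚ :=
  (1 / (n : ℚ)) * ∑ k ∈ Finset.range n, G.payoff (π (i + k)) (π (i + k + 1))

/-- The fixed window mean-payoff objective with window length `ℓ`. -/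
def fwmp (G : StochasticGame V) (ℓ : ℕ) : Set (ℕ → V) :=
  {π | π ∈ G.plays ∧ ∃ k, ∀ i, k ≤ i → ∃ j ∈ Finset.Icc 1 ℓ, 0 ≤ G.meanPayoff π i j}

/-! ### Strategies -/

/-- A (deterministic) strategy of Player `i`. `toFun ρ v` is the successor of `v` chosen after the
prefix `ρ ++ [v]`; only the values at prefixes whose last vertex `v` belongs to Player `i`
matter. -/
structure Strategy (G : StochasticGame V) (i : Player) where
  toFun : List V → V → V
  legal : ∀ ρ v, G.IsPath (ρ ++ [v]) → G.owner v = some i → G.edge v (toFun ρ v)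

/-- The infinite sequence `π` is consistent with the strategy `σ`. -/
def Strategy.Consistent {G : StochasticGame V} {i : Player} (σ : G.Strategy i)
    (π : ℕ → V) : Prop :=
  ∀ j, G.owner (π j) = some i → π (j + 1) = σ.toFun (history π j) (π j)

/-- The finite sequence `w` is consistent with the strategy `σ`. -/
def Strategy.ConsistentList {G : StochasticGame V} {i : Player} (σ : G.Strategy i)
    (w : List V) : Prop :=
  ∀ ρ v v', ρ ++ [v, v'] <+: w → G.owner v = some i → v' = σ.toFun ρ v

/-- `σ` is (surely) winning for the objective `O` from the initial vertex `v`. -/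
def Strategy.WinsFrom {G : StochasticGame V} {i : Player} (σ : G.Strategy i)
    (O : Set (ℕ → V)) (v : V) : Prop :=
  ∀ π ∈ G.plays, π 0 = v → σ.Consistent π → π ∈ O

/-- The winning region of Player `i` for the objective `O`, used in non-stochastic games. -/
def winningRegion (G : StochasticGame V) (i : Player) (O : Set (ℕ → V)) : Set V :=
  {v | ∃ σ : G.Strategy i, σ.WinsFrom O v}

/-- The Mealy machine `M` defines the strategy `σ` of Player `i`; `none` is the output `ε`. -/
def Strategy.DefinedBy {G : StochasticGame V} {i : Player} {Q : Type*} (σ : G.Strategy i)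
    (M : MealyMachine Q V (Option V)) : Prop :=
  ∀ ρ v, G.IsPath (ρ ++ [v]) → G.owner v = some i →
    M.out (M.run ρ) v = some (σ.toFun ρ v)

/-- The least number of states of a Mealy machine defining `σ` (`⊤` if there is no finite one). -/
noncomputable def Strategy.memorySize {G : StochasticGame V} {i : Player}
    (σ : G.Strategy i) : ℕ∞ :=
  sInf {c | ∃ (n : ℕ) (M : MealyMachine (Fin n) V (Option V)), σ.DefinedBy M ∧ c = n}

/-! ### The probability measure of a strategy profile -/

/-- The distribution of the next vertex after the prefix `ρ ++ [v]`. -/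
noncomputable def nextDist (G : StochasticGame V) (σ : G.Strategy .one) (τ : G.Strategy .two)
    (ρ : List V) (v : V) : PMF V :=
  match h : G.owner v with
  | none => G.prob ⟨v, h⟩
  | some .one => PMF.pure (σ.toFun ρ v)
  | some .two => PMF.pure (τ.toFun ρ v)

/-- The transition kernel from `v₀, …, vₙ` to the next vertex. -/
noncomputable def stepKernel [Countable V] [MeasurableSpace V] [DiscreteMeasurableSpace V]
    (G : StochasticGame V) (σ : G.Strategy .one) (τ : G.Strategy .two) (n : ℕ) :
    Kernel (Finset.Iic n → V) V :=
  Kernel.ofFunOfCountable fun x =>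
    (G.nextDist σ τ (List.ofFn fun k : Fin n => x ⟨k, Finset.mem_Iic.2 k.2.le⟩)
      (x ⟨n, Finset.mem_Iic.2 le_rfl⟩)).toMeasure

instance [Countable V] [MeasurableSpace V] [DiscreteMeasurableSpace V]
    (G : StochasticGame V) (σ : G.Strategy .one) (τ : G.Strategy .two) (n : ℕ) :
    IsMarkovKernel (G.stepKernel σ τ n) :=
  ⟨fun _ => PMF.toMeasure.isProbabilityMeasure _⟩

/-- The law, on infinite sequences of vertices, of the outcome of the profile `(σ, τ)` with initial
vertex `v`. Its values on cones are given by `outcomeMeasure_zero` and `outcomeMeasure_succ`. -/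
noncomputable def outcomeMeasure [Countable V] [MeasurableSpace V] [DiscreteMeasurableSpace V]
    (G : StochasticGame V) (σ : G.Strategy .one) (τ : G.Strategy .two) (v : V) :
    Measure (ℕ → V) :=
  Kernel.trajMeasure (X := fun _ => V) (Measure.dirac v) (G.stepKernel σ τ)

instance [Countable V] [MeasurableSpace V] [DiscreteMeasurableSpace V]
    (G : StochasticGame V) (σ : G.Strategy .one) (τ : G.Strategy .two) (v : V) :
    IsProbabilityMeasure (G.outcomeMeasure σ τ v) := by
  unfold outcomeMeasure; infer_instance

theorem outcomeMeasure_succ [Countable V] [MeasurableSpace V] [DiscreteMeasurableSpace V]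
    (G : StochasticGame V) (σ : G.Strategy .one) (τ : G.Strategy .two) (v : V)
    (π : ℕ → V) (n : ℕ) :
    G.outcomeMeasure σ τ v {π' | ∀ k ≤ n + 1, π' k = π k} =
      G.outcomeMeasure σ τ v {π' | ∀ k ≤ n, π' k = π k} *
        G.nextDist σ τ (history π n) (π n) (π (n + 1)) := by
  have key := Kernel.map_frestrictLe_trajMeasure_compProd_eq_map_trajMeasure
    (X := fun _ => V) (μ₀ := Measure.dirac v) (κ := G.stepKernel σ τ) (a := n)
  have h1 : {π' : ℕ → V | ∀ k ≤ n + 1, π' k = π k} =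
      (fun x : ℕ → V => (Preorder.frestrictLe n x, x (n + 1))) ⁻¹'
        ({Preorder.frestrictLe (π := fun _ => V) n π} ×ˢ {π (n + 1)}) := by
    ext x
    simp only [Set.mem_ofPred_eq, Set.mem_preimage, Set.mem_prod, Set.mem_singleton_iff,
      funext_iff, Subtype.forall, Finset.mem_Iic, Preorder.frestrictLe_apply]
    constructor
    · intro h
      exact ⟨fun k hk => h k (by omega), h _ le_rfl⟩
    · rintro ⟨h, h'⟩ k hk
      rcases Nat.lt_or_ge n k with h2 | h2
      · obtain rfl : k = n + 1 := by omega
        exact h'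
      · exact h k h2
  have h2 : {π' : ℕ → V | ∀ k ≤ n, π' k = π k} =
      (Preorder.frestrictLe (π := fun _ => V) n) ⁻¹'
        {Preorder.frestrictLe (π := fun _ => V) n π} := by
    ext x
    simp only [Set.mem_ofPred_eq, Set.mem_preimage, Set.mem_singleton_iff,
      funext_iff, Subtype.forall, Finset.mem_Iic, Preorder.frestrictLe_apply]
  have ms : MeasurableSet ({Preorder.frestrictLe (π := fun _ => V) n π} :
      Set (Finset.Iic n → V)) := measurableSet_singleton _
  rw [h1, h2, outcomeMeasure, ← Measure.map_apply (by fun_prop)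
    (ms.prod (measurableSet_singleton _)), ← key,
    Measure.compProd_apply_prod ms (measurableSet_singleton _),
    ← Measure.map_apply (by fun_prop) ms, Measure.restrict_singleton, lintegral_smul_measure,
    lintegral_dirac, smul_eq_mul]
  congr 1
  exact PMF.toMeasure_apply_singleton _ _ (measurableSet_singleton _)

theorem outcomeMeasure_zero [Countable V] [MeasurableSpace V] [DiscreteMeasurableSpace V]
    (G : StochasticGame V) (σ : G.Strategy .one) (τ : G.Strategy .two) (v v' : V) :
    G.outcomeMeasure σ τ v {π' | π' 0 = v'} = Set.indicator {v'} 1 v := by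
  have key : (G.outcomeMeasure σ τ v).map (Preorder.frestrictLe (π := fun _ => V) 0) =
      (Measure.dirac v).map
        (MeasurableEquiv.piUnique (fun _ : Finset.Iic 0 => V)).symm := by
    rw [outcomeMeasure, Kernel.trajMeasure, Measure.map_comp _ _ (by fun_prop),
      Kernel.traj_map_frestrictLe, Kernel.partialTraj_self, Measure.id_comp]
  have m0 : MeasurableSet {x : Finset.Iic 0 → V | x ⟨0, Finset.mem_Iic.2 le_rfl⟩ = v'} :=
    Set.Countable.measurableSet (Set.to_countable _)
  have h : {π' : ℕ → V | π' 0 = v'} = Preorder.frestrictLe (π := fun _ => V) 0 ⁻¹'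
      {x : Finset.Iic 0 → V | x ⟨0, Finset.mem_Iic.2 le_rfl⟩ = v'} := rfl
  rw [h, ← Measure.map_apply (by fun_prop) m0, key, Measure.map_apply (by fun_prop) m0,
    Measure.dirac_apply]
  rfl

/-- `τ` is an almost-sure winning strategy of Player 2 from `v` for his objective `O`. -/
def Strategy.AlmostSureWinsFrom [Countable V] [MeasurableSpace V] [DiscreteMeasurableSpace V]
    {G : StochasticGame V} (τ : G.Strategy .two) (O : Set (ℕ → V)) (v : V) : Prop :=
  ∀ σ : G.Strategy .one, G.outcomeMeasure σ τ v O = 1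

/-- The almost-sure winning region of Player 2 for his objective `O`. -/
def almostSureWinningRegionTwo [Countable V] [MeasurableSpace V] [DiscreteMeasurableSpace V]
    (G : StochasticGame V) (O : Set (ℕ → V)) : Set V :=
  {v | ∃ τ : G.Strategy .two, τ.AlmostSureWinsFrom O v}

/-- `O` is a prefix-independent objective (a Borel set of plays) with the sure-almost-sure
property. -/
structure HasSAS [Countable V] [MeasurableSpace V] [DiscreteMeasurableSpace V]
    (G : StochasticGame V) (O : Set (ℕ → V)) : Prop where
  subset_plays : O ⊆ G.plays
  measurableSet : MeasurableSet O
  prefixIndependent : G.PrefixIndependent O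
  sure_almostSure : G.adversarial.winningRegion .two (G.adversarial.compl O) = Set.univ →
    G.almostSureWinningRegionTwo (G.compl O) = Set.univ

/-! ### Reset strategies -/

/-- The transition of `M` from state `q` on reading `v` is reachable: it is taken after some prefix
`ρ ++ [v]` of the adversarial game that is consistent with `σ`. -/
def ReachableTransition (G : StochasticGame V) {Q : Type*} (σ : G.adversarial.Strategy .two)
    (M : MealyMachine Q V (Option V)) (q : Q) (v : V) : Prop :=
  ∃ ρ, G.adversarial.IsPath (ρ ++ [v]) ∧ σ.ConsistentList (ρ ++ [v]) ∧ M.run ρ = q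

open Classical in
/-- The reset machine: it copies `M` on reachable transitions, and otherwise behaves as `M` does
when the game starts in the current vertex; it outputs `ε` except at vertices of Player 2. -/
noncomputable def resetMachine (G : StochasticGame V) {Q : Type*}
    (σ : G.adversarial.Strategy .two) (M : MealyMachine Q V (Option V)) :
    MealyMachine Q V (Option V) where
  init := M.init
  trans q v := if G.ReachableTransition σ M q v then M.trans q v else M.trans M.init v
  out q v :=
    if G.owner v = some .two then
      if G.ReachableTransition σ M q v then M.out q v else M.out M.init v
    else none

end StochasticGame

/-! ### Histories -/

section History

variable {V : Type*}

/-! Player 2's objective says that bad windows, those still open after `ℓ` steps, occur infinitely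
often, and whether a window is bad is decided by finitely many vertices. As `V` is finite, the
sequences are compact, so whenever a family of local constraints forces a bad window, it forces one
within a uniform number `N` of steps (`exists_bound_badWindow`).

For finite memory, choose a winning strategy for each vertex and start afresh, with the one for the
current vertex, in blocks longer than every bound. Each block then contains a bad window
(`exists_finite_memory_winsFrom`).

For reset strategies, any sequence that follows `M` from a reachable pair continues a consistent
prefix, so it contains a bad window within `N` steps, uniformly in the state
(`exists_bound_of_reachableTransition`). In `G`, a reset always lands on a reachable pair, and as
long as chance happens to choose what `M` prescribes, pairs remain reachable and no further reset
occurs (`ReachableTransition.step`). Chance does so for `N` steps with probability at least `p ^ N`,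
where `p > 0` bounds the edge probabilities below. Hence almost surely bad windows recur forever
(`outcomeMeasure_compl_fwmp`). The SAS property combines both constructions; the memory bound holds
because the reset machine has the states of `M`. -/

@[simp] theorem history_zero (π : ℕ → V) : history π 0 = [] := rfl

theorem history_succ (π : ℕ → V) (n : ℕ) : history π (n + 1) = history π n ++ [π n] := by
  rw [history, List.ofFn_succ_last]
  simp [history]

@[simp] theorem length_history (π : ℕ → V) (n : ℕ) : (history π n).length = n := by
  simp [history]

theorem history_congr {π π' : ℕ → V} {n : ℕ} (h : ∀ k < n, π k = π' k) :
    history π n = history π' n := by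
  simp only [history]
  congr 1
  funext k
  exact h k k.2

theorem history_add (π : ℕ → V) (m n : ℕ) :
    history π (m + n) = history π m ++ history (fun k => π (m + k)) n := by
  induction n with
  | zero => simp
  | succ n ih => rw [← add_assoc, history_succ, ih, history_succ, List.append_assoc]

theorem history_prefix (π : ℕ → V) {m n : ℕ} (h : m ≤ n) : history π m <+: history π n := by
  obtain ⟨k, rfl⟩ := Nat.exists_eq_add_of_le h
  exact ⟨_, (history_add π m k).symm⟩

theorem isChain_history_succ {R : V → V → Prop} {π : ℕ → V} {n : ℕ} :
    (history π (n + 1)).IsChain R ↔ ∀ k < n, R (π k) (π (k + 1)) := by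
  induction n with
  | zero => simp [history_succ]
  | succ n ih =>
    rw [history_succ, List.isChain_append, ih]
    constructor
    · rintro ⟨h, -, h'⟩ k hk
      rcases Nat.lt_succ_iff_lt_or_eq.1 hk with hk | rfl
      · exact h k hk
      · exact h' _ (by simp [history_succ]) _ (by simp)
    · intro h
      refine ⟨fun k hk => h k (by omega), List.isChain_singleton _, ?_⟩
      intro x hx y hy
      simp only [history_succ, List.getLast?_append, List.getLast?_singleton, Option.some_or,
        Option.mem_def, Option.some.injEq, List.head?_cons] at hx hy
      subst hx hy
      exact h n (by omega)

/-- The sequence `π` preceded by the word `ρ`. -/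
def prepend (ρ : List V) (π : ℕ → V) (k : ℕ) : V := (ρ[k]?).getD (π (k - ρ.length))

@[simp] theorem prepend_length_add (ρ : List V) (π : ℕ → V) (k : ℕ) :
    prepend ρ π (ρ.length + k) = π k := by
  simp [prepend]

theorem history_prepend (ρ : List V) (π : ℕ → V) : history (prepend ρ π) ρ.length = ρ := by
  apply List.ext_getElem
  · simp
  · intro k h1 h2
    simp [history, prepend]

theorem history_prepend_add (ρ : List V) (π : ℕ → V) (n : ℕ) :
    history (prepend ρ π) (ρ.length + n) = ρ ++ history π n := by
  rw [history_add, history_prepend]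
  simp

/-- Finitely many steps of the sequence that continues `x` as `f` prescribes. -/
theorem exists_continuation (f : List V → V → V) (x : ℕ → V) (n m : ℕ) :
    ∃ π : ℕ → V, (∀ k ≤ n, π k = x k) ∧
      ∀ k < m, π (n + k + 1) = f (history π (n + k)) (π (n + k)) := by
  induction m with
  | zero => exact ⟨x, by simp⟩
  | succ m ih =>
    obtain ⟨π, h1, h2⟩ := ih
    set π' := Function.update π (n + m + 1) (f (history π (n + m)) (π (n + m)))
    have e : ∀ k ≤ n + m, π' k = π k := fun k hk =>
      Function.update_of_ne (by omega) _ _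
    have eh : ∀ k ≤ n + m, history π' k = history π k := fun k hk =>
      history_congr fun j hj => e j (by omega)
    refine ⟨π', fun k hk => (e k (by omega)).trans (h1 k hk), fun k hk => ?_⟩
    rw [eh _ (by omega), e (n + k) (by omega)]
    rcases Nat.lt_succ_iff_lt_or_eq.1 hk with hk | rfl
    · rw [e _ (by omega), h2 k hk]
    · exact Function.update_self _ _ _

/-- Kőnig's lemma. -/
theorem exists_forall_of_antitone [Finite V] (P : ℕ → (ℕ → V) → Prop)
    (anti : ∀ n π, P (n + 1) π → P n π)
    (loc : ∀ n π π', (∀ k ≤ n, π k = π' k) → P n π → P n π')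
    (ex : ∀ n, ∃ π, P n π) : ∃ π, ∀ n, P n π := by
  let _ : TopologicalSpace V := ⊥
  have : DiscreteTopology V := ⟨rfl⟩
  -- Each condition is pulled back from finitely many coordinates, hence from a discrete space.
  have hc : ∀ n, IsClosed {π | P n π} := by
    intro n
    have : {π | P n π} = (fun (π : ℕ → V) (k : Fin (n + 1)) => π k) ⁻¹'
        ((fun (π : ℕ → V) (k : Fin (n + 1)) => π k) '' {π | P n π}) := by
      refine (Set.subset_preimage_image _ _).antisymm ?_
      rintro π ⟨π', h, h'⟩
      exact loc n π' π (fun k hk => congrFun h' ⟨k, by omega⟩) h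
    rw [this]
    exact (isClosed_discrete _).preimage (by fun_prop)
  obtain ⟨π, hπ⟩ := IsCompact.nonempty_iInter_of_sequence_nonempty_isCompact_isClosed
    (fun n => {π | P n π}) (fun n π h => anti n π h) ex (hc 0).isCompact hc
  exact ⟨π, fun n => Set.mem_iInter.1 hπ n⟩

end History

/-! ### Cylinders -/

section Cylinder

theorem measurable_restrict_fin {V : Type*} [MeasurableSpace V] (n : ℕ) :
    Measurable (fun (π : ℕ → V) (k : Fin n) => π k) :=
  measurable_pi_lambda _ fun _ => measurable_pi_apply _

variable {V : Type*} [Finite V] [MeasurableSpace V] [DiscreteMeasurableSpace V]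

/-- Such a set is the preimage of its own projection to a finite set of tuples. -/
theorem measurableSet_of_forall_eq {S : Set (ℕ → V)} (n : ℕ)
    (h : ∀ π π', (∀ k ≤ n, π k = π' k) → π ∈ S → π' ∈ S) : MeasurableSet S := by
  have : S = (fun (π : ℕ → V) (k : Fin (n + 1)) => π k) ⁻¹'
      ((fun (π : ℕ → V) (k : Fin (n + 1)) => π k) '' S) := by
    refine (Set.subset_preimage_image _ _).antisymm ?_
    rintro π ⟨π', h1, h2⟩
    exact h π' π (fun k hk => congrFun h2 ⟨k, by omega⟩) h1
  rw [this]
  exact measurable_restrict_fin _ (Set.toFinite _).measurableSet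

/-- Measures of sets may be compared within each cylinder of a fixed depth. -/
theorem measure_le_of_cylinder_le {μ ν : Measure (ℕ → V)} (n : ℕ) {S T : Set (ℕ → V)}
    (hS : MeasurableSet S) (hT : MeasurableSet T)
    (h : ∀ x : ℕ → V, μ (S ∩ {π | ∀ k ≤ n, π k = x k}) ≤ ν (T ∩ {π | ∀ k ≤ n, π k = x k})) :
    μ S ≤ ν T := by
  classical
  have := Fintype.ofFinite (Fin (n + 1) → V)
  -- Finitely many disjoint cylinders of depth `n` cover the space.
  have key : ∀ (κ : Measure (ℕ → V)) (A : Set (ℕ → V)), MeasurableSet A →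
      κ A = ∑ y : Fin (n + 1) → V,
        κ (A ∩ (fun (π : ℕ → V) (k : Fin (n + 1)) => π k) ⁻¹' {y}) := by
    intro κ A hA
    have hm : ∀ y : Fin (n + 1) → V,
        MeasurableSet ((fun (π : ℕ → V) (k : Fin (n + 1)) => π k) ⁻¹' {y}) := fun y =>
      measurable_restrict_fin _ (Set.toFinite _).measurableSet
    rw [← measure_biUnion_finset (fun a _ b _ hab => ?_) (fun y _ => hA.inter (hm y))]
    · congr 1
      ext π
      simp
    · refine Set.disjoint_left.2 ?_
      rintro π ⟨-, h1⟩ ⟨-, h2⟩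
      exact hab (h1.symm.trans h2)
  rw [key μ S hS, key ν T hT]
  refine Finset.sum_le_sum fun y _ => ?_
  rcases ((fun (π : ℕ → V) (k : Fin (n + 1)) => π k) ⁻¹' {y}).eq_empty_or_nonempty with
    he | ⟨x, hx⟩
  · simp [he]
  · have : (fun (π : ℕ → V) (k : Fin (n + 1)) => π k) ⁻¹' {y} = {π | ∀ k ≤ n, π k = x k} := by
      ext π
      simp only [Set.mem_preimage, Set.mem_singleton_iff] at hx ⊢
      rw [← hx, funext_iff]
      exact ⟨fun h k hk => h ⟨k, by omega⟩, fun h k => h k (by omega)⟩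
    rw [this]
    exact h x

theorem measure_eq_zero_of_cylinder {μ : Measure (ℕ → V)} (n : ℕ) {S : Set (ℕ → V)}
    (hS : MeasurableSet S) (h : ∀ x ∈ S, μ {π | ∀ k ≤ n, π k = x k} = 0) : μ S = 0 := by
  refine le_antisymm ((measure_le_of_cylinder_le (ν := 0) n hS hS fun x => ?_).trans_eq (by simp))
    (zero_le)
  rcases (S ∩ {π | ∀ k ≤ n, π k = x k}).eq_empty_or_nonempty with he | ⟨y, hy, hyx⟩
  · simp [he]
  · have : {π : ℕ → V | ∀ k ≤ n, π k = x k} = {π | ∀ k ≤ n, π k = y k} := by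
      ext π
      exact forall₂_congr fun k hk => by rw [hyx k hk]
    rw [this]
    exact ((measure_mono Set.inter_subset_right).trans_eq (h y hy)).trans zero_le

/-- An event which, from any finite prefix on, fails within the next `N` steps with probability
at least `ε` has probability zero. -/
theorem measure_iInter_eq_zero_of_cylinder {μ : Measure (ℕ → V)} [IsProbabilityMeasure μ]
    {S : ℕ → Set (ℕ → V)} (anti : Antitone S)
    (loc : ∀ n π π', (∀ k ≤ n, π k = π' k) → π ∈ S n → π' ∈ S n) (m N : ℕ) {ε : ENNReal}
    (hε : ε ≠ 0)
    (h : ∀ n, m ≤ n → ∀ x : ℕ → V, ε * μ {π | ∀ k ≤ n, π k = x k} ≤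
      μ ({π | ∀ k ≤ n, π k = x k} \ S (n + N))) :
    μ (⋂ n, S n) = 0 := by
  have hS : ∀ n, MeasurableSet (S n) := fun n => measurableSet_of_forall_eq n (loc n)
  -- Every `N` steps the surviving mass shrinks by a factor of at most `1 - ε`. It suffices to check
  -- this on each cylinder, which lies inside `S n` or misses it.
  have step : ∀ n, m ≤ n → μ (S (n + N)) ≤ (1 - ε) * μ (S n) := by
    intro n hn
    refine measure_le_of_cylinder_le (ν := (1 - ε) • μ) n (hS _) (hS _) fun x => ?_
    set C := {π : ℕ → V | ∀ k ≤ n, π k = x k}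
    by_cases hx : x ∈ S n
    · have hsub : C ⊆ S n := fun π hπ => loc n x π (fun k hk => (hπ k hk).symm) hx
      rw [Measure.smul_apply, smul_eq_mul, Set.inter_eq_self_of_subset_right hsub, Set.inter_comm,
        ENNReal.sub_mul (fun _ _ => measure_ne_top _ _), one_mul]
      refine ENNReal.le_sub_of_add_le_right
        (ne_top_of_le_ne_top (measure_ne_top μ _) (h n hn x)) ?_
      calc μ (C ∩ S (n + N)) + ε * μ C ≤ μ (C ∩ S (n + N)) + μ (C \ S (n + N)) := by
            gcongr
            exact h n hn x
        _ = μ C := measure_inter_add_sdiff _ (hS _)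
    · have : S (n + N) ∩ C = ∅ := by
        rw [Set.eq_empty_iff_forall_notMem]
        rintro π ⟨h1, h2⟩
        exact hx (loc n π x (fun k hk => h2 k hk) (anti (Nat.le_add_right n N) h1))
      simp [this]
  have pow : ∀ k, μ (S (m + k * N)) ≤ (1 - ε) ^ k := by
    intro k
    induction k with
    | zero => simpa using prob_le_one
    | succ k ih =>
      rw [Nat.succ_mul, ← add_assoc, pow_succ']
      exact (step _ (by omega)).trans (by gcongr)
  have lim := ENNReal.tendsto_pow_atTop_nhds_zero_of_lt_one
    (ENNReal.sub_lt_self ENNReal.one_ne_top one_ne_zero hε)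
  refine le_antisymm (ge_of_tendsto' lim fun k => ?_) zero_le
  exact (measure_mono (Set.iInter_subset _ _)).trans (pow k)

end Cylinder

namespace StochasticGame

variable {V : Type*}

/-! ### Windows -/

/-- The window opened at position `i` is still open after `ℓ` steps. -/
def BadWindow (G : StochasticGame V) (ℓ : ℕ) (π : ℕ → V) (i : ℕ) : Prop :=
  ∀ j ∈ Finset.Icc 1 ℓ, G.meanPayoff π i j < 0

theorem meanPayoff_congr (G : StochasticGame V) {π π' : ℕ → V} {i n : ℕ}
    (h : ∀ k ≤ i + n, π k = π' k) : G.meanPayoff π i n = G.meanPayoff π' i n := by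
  unfold meanPayoff
  congr 1
  refine Finset.sum_congr rfl fun k hk => ?_
  have := Finset.mem_range.1 hk
  rw [h _ (by omega), h _ (by omega)]

theorem meanPayoff_shift (G : StochasticGame V) (π : ℕ → V) (s i n : ℕ) :
    G.meanPayoff (fun k => π (s + k)) i n = G.meanPayoff π (s + i) n := by
  simp only [meanPayoff, add_assoc]

theorem BadWindow.congr {G : StochasticGame V} {ℓ : ℕ} {π π' : ℕ → V} {i : ℕ}
    (h : ∀ k ≤ i + ℓ, π k = π' k) (hb : G.BadWindow ℓ π i) : G.BadWindow ℓ π' i := by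
  intro j hj
  rw [← G.meanPayoff_congr fun k hk => h k (hk.trans (by have := Finset.mem_Icc.1 hj; omega))]
  exact hb j hj

theorem badWindow_shift {G : StochasticGame V} {ℓ : ℕ} {π : ℕ → V} {s i : ℕ} :
    G.BadWindow ℓ (fun k => π (s + k)) i ↔ G.BadWindow ℓ π (s + i) := by
  simp only [BadWindow, meanPayoff_shift]

/-- The Büchi form of Player 2's objective, used throughout in place of the definition. -/
theorem mem_compl_fwmp {G : StochasticGame V} {ℓ : ℕ} {π : ℕ → V} :
    π ∈ G.compl (G.fwmp ℓ) ↔ π ∈ G.plays ∧ ∀ k, ∃ i, k ≤ i ∧ G.BadWindow ℓ π i := by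
  simp only [compl, fwmp, BadWindow, Set.mem_sdiff, Set.mem_ofPred_eq]
  refine and_congr_right fun h => ?_
  simp only [h, true_and]
  push Not
  rfl

theorem plays_shift {G : StochasticGame V} {π : ℕ → V} (h : π ∈ G.plays) (s : ℕ) :
    (fun k => π (s + k)) ∈ G.plays := fun i => h (s + i)

theorem fwmp_prefixIndependent (G : StochasticGame V) (ℓ : ℕ) :
    G.PrefixIndependent (G.fwmp ℓ) := by
  constructor
  · rintro π ⟨hπ, k, hk⟩ s
    refine ⟨plays_shift hπ s, k, fun i hi => ?_⟩
    simpa only [meanPayoff_shift] using hk (s + i) (by omega)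
  · rintro π hπ s ⟨-, k, hk⟩
    refine ⟨hπ, s + k, fun i hi => ?_⟩
    obtain ⟨i, rfl⟩ := Nat.exists_eq_add_of_le (Nat.le_of_add_right_le hi)
    simpa only [meanPayoff_shift] using hk i (by omega)

/-! ### Borel measurability of the objectives. -/

section Measurability

variable [Finite V] [MeasurableSpace V] [DiscreteMeasurableSpace V]

theorem measurableSet_edge (G : StochasticGame V) (i : ℕ) :
    MeasurableSet {π : ℕ → V | G.edge (π i) (π (i + 1))} :=
  measurableSet_of_forall_eq (i + 1) fun π π' h hπ => by
    rw [Set.mem_ofPred_eq] at hπ ⊢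
    rwa [← h i (by omega), ← h (i + 1) le_rfl]

theorem measurableSet_plays (G : StochasticGame V) : MeasurableSet G.plays := by
  have : G.plays = ⋂ i, {π : ℕ → V | G.edge (π i) (π (i + 1))} := by
    ext; simp [plays]
  rw [this]
  exact MeasurableSet.iInter G.measurableSet_edge

theorem measurableSet_badWindow (G : StochasticGame V) (ℓ i : ℕ) :
    MeasurableSet {π : ℕ → V | G.BadWindow ℓ π i} :=
  measurableSet_of_forall_eq (i + ℓ) fun _ _ h hπ => BadWindow.congr h hπ

theorem measurableSet_compl_fwmp (G : StochasticGame V) (ℓ : ℕ) :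
    MeasurableSet (G.compl (G.fwmp ℓ)) := by
  have : G.compl (G.fwmp ℓ) =
      G.plays ∩ ⋂ k, ⋃ i, ⋃ _ : k ≤ i, {π : ℕ → V | G.BadWindow ℓ π i} := by
    ext; simp [mem_compl_fwmp]
  rw [this]
  exact G.measurableSet_plays.inter (MeasurableSet.iInter fun k => MeasurableSet.iUnion fun i =>
    MeasurableSet.iUnion fun _ => G.measurableSet_badWindow ℓ i)

theorem measurableSet_fwmp (G : StochasticGame V) (ℓ : ℕ) : MeasurableSet (G.fwmp ℓ) := by
  have : G.fwmp ℓ = G.plays \ G.compl (G.fwmp ℓ) := by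
    rw [compl, Set.sdiff_sdiff_cancel_left fun π hπ => hπ.1]
  rw [this]
  exact G.measurableSet_plays.diff (G.measurableSet_compl_fwmp ℓ)

end Measurability

/-- If every sequence subject to local constraints contains a bad window, then a bad window occurs
within a bounded number of steps. -/
theorem exists_bound_badWindow [Finite V] (G : StochasticGame V) (ℓ : ℕ)
    (C : ℕ → (ℕ → V) → Prop) (anti : ∀ n π, C (n + 1) π → C n π)
    (loc : ∀ n π π', (∀ k ≤ n, π k = π' k) → C n π → C n π')
    (h : ∀ π, (∀ n, C n π) → ∃ i, G.BadWindow ℓ π i) :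
    ∃ N, ∀ π, C N π → ∃ i, i + ℓ ≤ N ∧ G.BadWindow ℓ π i := by
  by_contra! hcon
  -- If no bound works, each `n` has a sequence obeying the constraints to depth `n` without a
  -- completed bad window; Kőnig's lemma yields one that serves for all `n`.
  obtain ⟨π, hπ⟩ := exists_forall_of_antitone
    (fun n π => C n π ∧ ∀ i, i + ℓ ≤ n → ¬ G.BadWindow ℓ π i)
    (fun n π hn => ⟨anti n π hn.1, fun i hi => hn.2 i (by omega)⟩)
    (fun n π π' he hn => ⟨loc n π π' he hn.1, fun i hi hb =>
      hn.2 i hi (hb.congr fun k hk => (he k (by omega)).symm)⟩) hcon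
  obtain ⟨i, hi⟩ := h π fun n => (hπ n).1
  exact (hπ (i + ℓ)).2 i le_rfl hi

end StochasticGame

/-! ### Uniform finite-memory strategies for sure winning -/

namespace MealyMachine

variable {Q Q' A B : Type*}

@[simp] theorem run_nil (M : MealyMachine Q A B) : M.run [] = M.init := rfl

theorem run_append_singleton (M : MealyMachine Q A B) (w : List A) (a : A) :
    M.run (w ++ [a]) = M.trans (M.run w) a := by
  simp [run]

/-- Renaming of the states. -/
def mapEquiv (M : MealyMachine Q A B) (e : Q ≃ Q') : MealyMachine Q' A B where
  init := e M.init
  trans q a := e (M.trans (e.symm q) a)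
  out q a := M.out (e.symm q) a

theorem run_mapEquiv (M : MealyMachine Q A B) (e : Q ≃ Q') (w : List A) :
    (M.mapEquiv e).run w = e (M.run w) := by
  induction w using List.reverseRecOn with
  | nil => rfl
  | append_singleton w a ih =>
    rw [run_append_singleton, run_append_singleton, ih]
    simp [mapEquiv]

/-- The machine that runs `f` on the word read since the last multiple of `N` steps, together with
the first letter of that word. -/
def restart (f : A → List A → A → A) (N : ℕ) (hN : 0 < N) :
    MealyMachine {w : List A // w.length < N} A (Option A) where
  init := ⟨[], hN⟩
  trans q v := if h : q.1.length + 1 < N then ⟨q.1 ++ [v], by simpa using h⟩ else ⟨[], hN⟩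
  -- With an empty buffer the head is `v` itself, so a block starts at the letter being read.
  out q v := some (f ((q.1 ++ [v]).head (by simp)) q.1 v)

/-- Makes the outputs legal: a suffix of a path is a path, so the block strategy is consulted only
on genuine prefixes. -/
theorem run_restart_suffix (f : A → List A → A → A) {N : ℕ} (hN : 0 < N) (w : List A) :
    ((restart f N hN).run w).1 <:+ w := by
  induction w using List.reverseRecOn with
  | nil => exact List.nil_suffix
  | append_singleton w a ih =>
    rw [run_append_singleton]
    simp only [restart] at ih ⊢
    split_ifs
    · obtain ⟨u, hu⟩ := ih
      exact ⟨u, by rw [← List.append_assoc, hu]⟩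
    · exact List.nil_suffix

theorem run_restart_add (f : A → List A → A → A) {N : ℕ} (hN : 0 < N) {π : ℕ → A} {t : ℕ}
    (ht : ((restart f N hN).run (history π t)).1 = []) {j : ℕ} (hj : j < N) :
    ((restart f N hN).run (history π (t + j))).1 = history (fun k => π (t + k)) j := by
  induction j with
  | zero => simpa using ht
  | succ j ih =>
    have ih := ih (by omega)
    rw [← add_assoc, history_succ, run_append_singleton, history_succ]
    have h : ((restart f N hN).run (history π (t + j))).1.length + 1 < N := by
      rw [ih, length_history]; exact hj
    simp only [restart] at ih h ⊢
    rw [dif_pos h]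
    exact congrArg (· ++ [_]) ih

theorem run_restart_mul (f : A → List A → A → A) {N : ℕ} (hN : 0 < N) (π : ℕ → A) (b : ℕ) :
    ((restart f N hN).run (history π (b * N))).1 = [] := by
  induction b with
  | zero => simp [restart]
  | succ b ih =>
    have h1 := run_restart_add f hN ih (Nat.sub_lt hN one_pos)
    have e : (b + 1) * N = b * N + (N - 1) + 1 := by rw [Nat.succ_mul]; omega
    rw [e, history_succ, run_append_singleton]
    have h : ¬ ((restart f N hN).run (history π (b * N + (N - 1)))).1.length + 1 < N := by
      rw [h1, length_history]; omega
    simp only [restart] at h ⊢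
    rw [dif_neg h]

end MealyMachine

namespace StochasticGame

variable {V : Type*} {G : StochasticGame V} {i : Player}

theorem Strategy.memorySize_le (σ : G.Strategy i) {n : ℕ}
    {M : MealyMachine (Fin n) V (Option V)} (h : σ.DefinedBy M) : σ.memorySize ≤ n :=
  sInf_le ⟨n, M, h, rfl⟩

theorem Strategy.exists_definedBy_of_memorySize_ne_top {σ : G.Strategy i}
    (h : σ.memorySize ≠ ⊤) : ∃ (n : ℕ) (M : MealyMachine (Fin n) V (Option V)),
      σ.DefinedBy M ∧ σ.memorySize = n := by
  refine csInf_mem (s := {c : ℕ∞ | ∃ (n : ℕ) (M : MealyMachine (Fin n) V (Option V)),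
    σ.DefinedBy M ∧ c = n}) (Set.nonempty_iff_ne_empty.2 fun he => h ?_)
  rw [Strategy.memorySize, he, sInf_empty]

theorem Strategy.memorySize_ne_top {Q : Type*} [Finite Q] {σ : G.Strategy i}
    {M : MealyMachine Q V (Option V)} (h : σ.DefinedBy M) : σ.memorySize ≠ ⊤ := by
  obtain ⟨n, ⟨e⟩⟩ := Finite.exists_equiv_fin Q
  refine ne_top_of_le_ne_top (ENat.natCast_ne_top n) (σ.memorySize_le (M := M.mapEquiv e) ?_)
  intro ρ v hρ hv
  rw [M.run_mapEquiv]
  simpa [MealyMachine.mapEquiv] using h ρ v hρ hv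

/-- The strategy given by a machine whose outputs are legal. -/
def Strategy.ofMachine {Q : Type*} (M : MealyMachine Q V (Option V))
    (h : ∀ ρ v, G.IsPath (ρ ++ [v]) → G.owner v = some i →
      ∃ v', M.out (M.run ρ) v = some v' ∧ G.edge v v') : G.Strategy i where
  toFun ρ v := (M.out (M.run ρ) v).getD v
  legal ρ v hρ hv := by
    obtain ⟨v', h1, h2⟩ := h ρ v hρ hv
    rwa [h1]

theorem Strategy.ofMachine_definedBy {Q : Type*} (M : MealyMachine Q V (Option V))
    (h : ∀ ρ v, G.IsPath (ρ ++ [v]) → G.owner v = some i →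
      ∃ v', M.out (M.run ρ) v = some v' ∧ G.edge v v') :
    (Strategy.ofMachine M h).DefinedBy M := by
  intro ρ v hρ hv
  obtain ⟨v', h1, -⟩ := h ρ v hρ hv
  simp [Strategy.ofMachine, h1]

theorem exists_finite_memory_winsFrom [Finite V] (ℓ : ℕ)
    (h : G.winningRegion i (G.compl (G.fwmp ℓ)) = Set.univ) :
    ∃ σ : G.Strategy i, (∀ v, σ.WinsFrom (G.compl (G.fwmp ℓ)) v) ∧ σ.memorySize ≠ ⊤ := by
  have hw : ∀ v, ∃ σ : G.Strategy i, σ.WinsFrom (G.compl (G.fwmp ℓ)) v :=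
    fun v => (h.symm ▸ Set.mem_univ v : v ∈ G.winningRegion i (G.compl (G.fwmp ℓ)))
  choose σ hσ using hw
  -- The first `n` steps form a path from `v` consistent with `σ v`.
  let C : V → ℕ → (ℕ → V) → Prop := fun v n π => π 0 = v ∧
    ∀ j < n, G.edge (π j) (π (j + 1)) ∧
      (G.owner (π j) = some i → π (j + 1) = (σ v).toFun (history π j) (π j))
  have hN : ∀ v, ∃ N, ∀ π, C v N π → ∃ i, i + ℓ ≤ N ∧ G.BadWindow ℓ π i := by
    intro v
    refine G.exists_bound_badWindow ℓ (C v) (fun n π hn => ⟨hn.1, fun j hj => hn.2 j (by omega)⟩)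
      (fun n π π' he hn => ⟨he 0 (by omega) ▸ hn.1, fun j hj => ?_⟩) fun π hπ => ?_
    · rw [← history_congr fun k hk => he k (by omega), ← he j (by omega), ← he (j + 1) (by omega)]
      exact hn.2 j hj
    · obtain ⟨i, -, hi⟩ := (mem_compl_fwmp.1 (hσ v π
        (fun j => ((hπ (j + 1)).2 j (by omega)).1) (hπ 0).1
        fun j => ((hπ (j + 1)).2 j (by omega)).2)).2 0
      exact ⟨i, hi⟩
  choose N hN using hN
  obtain ⟨N', hN'⟩ := Finite.exists_le N
  -- The extra step keeps the block length positive.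
  have hpos : 0 < N' + 1 := by omega
  let M := MealyMachine.restart (fun v => (σ v).toFun) (N' + 1) hpos
  have hM : ∀ ρ v, G.IsPath (ρ ++ [v]) → G.owner v = some i →
      ∃ v', M.out (M.run ρ) v = some v' ∧ G.edge v v' := by
    intro ρ v hρ hv
    refine ⟨_, rfl, (σ _).legal _ v ?_ hv⟩
    obtain ⟨u, hu⟩ := MealyMachine.run_restart_suffix (fun v => (σ v).toFun) hpos ρ
    refine List.IsChain.suffix hρ ⟨u, ?_⟩
    rw [← List.append_assoc]
    exact congrArg (· ++ [v]) hu
  have : Finite {w : List V // w.length < N' + 1} := (List.finite_length_lt V (N' + 1)).to_subtype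
  refine ⟨.ofMachine M hM, fun v π hπ _ hc => mem_compl_fwmp.2 ⟨hπ, fun k => ?_⟩,
    Strategy.memorySize_ne_top (Strategy.ofMachine_definedBy M hM)⟩
  -- A block starts at `t ≥ k`, so its bad window lies beyond `k`.
  set t := k * (N' + 1) with ht
  have hC : C (π t) N' (fun k => π (t + k)) := by
    refine ⟨rfl, fun j hj => ⟨hπ (t + j), fun ho => ?_⟩⟩
    have hrun : (M.run (history π (t + j))).1 = history (fun k => π (t + k)) j :=
      MealyMachine.run_restart_add _ hpos (MealyMachine.run_restart_mul _ hpos π k) (by omega)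
    have h1 := hc (t + j) ho
    -- Stated for a variable `w` because `head` carries a proof that depends on the list.
    have h2 : ∀ (w : List V) (hw : (w ++ [π (t + j)]) ≠ []),
        w = history (fun k => π (t + k)) j → (w ++ [π (t + j)]).head hw = π t := by
      rintro w hw rfl
      have := history_succ (fun k => π (t + k)) j
      simp only [← this]
      simp [history]
    refine h1.trans ?_
    change (σ _).toFun _ _ = _
    rw [h2 _ _ hrun, hrun]
  obtain ⟨i, -, hi⟩ := hN (π t) _ ⟨hC.1, fun j hj => hC.2 j (hj.trans_le (hN' _))⟩
  refine ⟨t + i, ?_, badWindow_shift.1 hi⟩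
  have := Nat.le_mul_of_pos_right k hpos
  omega

end StochasticGame

namespace StochasticGame

variable {V : Type*} {G : StochasticGame V}

/-! ### Outcomes -/

theorem edge_of_nextDist_ne_zero {ξ : G.Strategy .one} {τ : G.Strategy .two} {ρ : List V}
    {v v' : V} (hρ : G.IsPath (ρ ++ [v])) (h : G.nextDist ξ τ ρ v v' ≠ 0) : G.edge v v' := by
  unfold nextDist at h
  split at h
  · exact (G.prob_support _ _).1 ((PMF.mem_support_iff _ _).2 h)
  · rename_i ho
    rw [← PMF.mem_support_iff, PMF.support_pure, Set.mem_singleton_iff] at h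
    exact h ▸ ξ.legal ρ v hρ ho
  · rename_i ho
    rw [← PMF.mem_support_iff, PMF.support_pure, Set.mem_singleton_iff] at h
    exact h ▸ τ.legal ρ v hρ ho

theorem exists_pos_le_prob [Finite V] (G : StochasticGame V) :
    ∃ p : ENNReal, p ≠ 0 ∧ p ≤ 1 ∧
      ∀ (v : {v : V // G.owner v = none}) (v' : V), G.edge v.1 v' → p ≤ G.prob v v' := by
  classical
  have := Fintype.ofFinite V
  -- Zero probabilities are replaced by `1` so that the minimum stays positive.
  let g : {v : V // G.owner v = none} × V → ENNReal := fun x =>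
    if G.prob x.1 x.2 = 0 then 1 else G.prob x.1 x.2
  refine ⟨min 1 (Finset.univ.inf g), ?_, min_le_left _ _, fun v v' h => ?_⟩
  · refine (lt_min one_pos ((Finset.lt_inf_iff ENNReal.zero_lt_top).2 fun x _ => ?_)).ne'
    simp only [g]
    split_ifs with h
    · exact one_pos
    · exact pos_iff_ne_zero.2 h
  · have h0 : G.prob v v' ≠ 0 := (PMF.mem_support_iff _ _).1 ((G.prob_support v v').2 h)
    calc min 1 (Finset.univ.inf g) ≤ g (v, v') :=
          (min_le_right _ _).trans (Finset.inf_le (Finset.mem_univ _))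
      _ = G.prob v v' := if_neg h0

/-! ### Null events and a criterion for infinitely many bad windows almost surely. -/

section Measure

variable [Finite V] [MeasurableSpace V] [DiscreteMeasurableSpace V]

theorem edge_of_outcomeMeasure_ne_zero {ξ : G.Strategy .one} {τ : G.Strategy .two} {v : V}
    {π : ℕ → V} {n : ℕ} (h : G.outcomeMeasure ξ τ v {π' | ∀ k ≤ n, π' k = π k} ≠ 0) :
    ∀ k < n, G.edge (π k) (π (k + 1)) := by
  induction n with
  | zero => simp
  | succ n ih =>
    rw [outcomeMeasure_succ, mul_ne_zero_iff] at h
    intro k hk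
    rcases Nat.lt_succ_iff_lt_or_eq.1 hk with hk | rfl
    · exact ih h.1 k hk
    · refine edge_of_nextDist_ne_zero ?_ h.2
      rw [← history_succ]
      exact isChain_history_succ.2 (ih h.1)

theorem outcomeMeasure_compl_plays (ξ : G.Strategy .one) (τ : G.Strategy .two) (v : V) :
    G.outcomeMeasure ξ τ v (G.playsᶜ) = 0 := by
  have : G.playsᶜ = ⋃ i, {π : ℕ → V | G.edge (π i) (π (i + 1))}ᶜ := by
    ext; simp [plays]
  rw [this, measure_iUnion_null_iff]
  intro i
  refine measure_eq_zero_of_cylinder (i + 1) (G.measurableSet_edge i).compl fun x hx => ?_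
  by_contra h
  exact hx (edge_of_outcomeMeasure_ne_zero h i (by omega))

theorem pow_mul_outcomeMeasure_le {ξ : G.Strategy .one} {τ : G.Strategy .two} {v : V}
    {π : ℕ → V} {n m : ℕ} {p : ENNReal}
    (h : ∀ k < m, p ≤ G.nextDist ξ τ (history π (n + k)) (π (n + k)) (π (n + k + 1))) :
    p ^ m * G.outcomeMeasure ξ τ v {π' | ∀ k ≤ n, π' k = π k} ≤
      G.outcomeMeasure ξ τ v {π' | ∀ k ≤ n + m, π' k = π k} := by
  induction m with
  | zero => simp
  | succ m ih =>
    rw [← add_assoc, outcomeMeasure_succ, pow_succ, mul_right_comm]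
    exact mul_le_mul' (ih fun k hk => h k (by omega)) (h m (by omega))

/-- If after every prefix of positive probability some continuation, each step of which has
probability at least `p`, contains a bad window within the next `N` steps, then almost surely bad
windows occur infinitely often. -/
theorem outcomeMeasure_compl_fwmp {ξ : G.Strategy .one} {τ : G.Strategy .two} {v : V} {ℓ N : ℕ}
    {p : ENNReal} (hp : p ≠ 0)
    (h : ∀ (n : ℕ) (x : ℕ → V), (∀ k < n, G.edge (x k) (x (k + 1))) →
      ∃ π : ℕ → V, (∀ k ≤ n, π k = x k) ∧
        (∀ k < N, p ≤ G.nextDist ξ τ (history π (n + k)) (π (n + k)) (π (n + k + 1))) ∧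
        ∃ i, n ≤ i ∧ i + ℓ ≤ n + N ∧ G.BadWindow ℓ π i) :
    G.outcomeMeasure ξ τ v (G.compl (G.fwmp ℓ)) = 1 := by
  rw [prob_compl_eq_zero_iff (G.measurableSet_compl_fwmp ℓ) |>.symm]
  set S : ℕ → ℕ → Set (ℕ → V) := fun m n => {π | ∀ i, m ≤ i → i + ℓ ≤ n → ¬ G.BadWindow ℓ π i}
  -- A failing sequence is not a play or has no bad window from some `m` on. The first event is
  -- null; the second is treated for each `m`.
  have hsub : (G.compl (G.fwmp ℓ))ᶜ ⊆ G.playsᶜ ∪ ⋃ m, ⋂ n, S m n := by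
    intro π hπ
    by_cases hpl : π ∈ G.plays
    · right
      rw [Set.mem_compl_iff, mem_compl_fwmp] at hπ
      push Not at hπ
      obtain ⟨m, hm⟩ := hπ hpl
      exact Set.mem_iUnion.2 ⟨m, Set.mem_iInter.2 fun n i hi _ => hm i hi⟩
    · exact Or.inl hpl
  refine measure_mono_null hsub (measure_union_null (outcomeMeasure_compl_plays ξ τ v)
    (measure_iUnion_null fun m => ?_))
  refine measure_iInter_eq_zero_of_cylinder (ε := p ^ N) (m := m) (N := N)
    (fun a b hab π hπ i hi hb => hπ i hi (hb.trans hab))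
    (fun n π π' he hπ i hi hb hw => hπ i hi hb (hw.congr fun k hk => (he k (by omega)).symm))
    (pow_ne_zero N hp) fun n hn x => ?_
  by_cases h0 : G.outcomeMeasure ξ τ v {π' | ∀ k ≤ n, π' k = x k} = 0
  · rw [h0, mul_zero]; exact zero_le
  obtain ⟨π, h1, h2, i, h3, h4, h5⟩ := h n x (edge_of_outcomeMeasure_ne_zero h0)
  have e : {π' : ℕ → V | ∀ k ≤ n, π' k = x k} = {π' | ∀ k ≤ n, π' k = π k} := by
    ext π'
    exact forall₂_congr fun k hk => by rw [h1 k hk]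
  rw [e]
  refine (pow_mul_outcomeMeasure_le h2).trans (measure_mono fun π' hπ' => ⟨fun k hk =>
    hπ' k (by omega), fun hc => ?_⟩)
  exact hc i (hn.trans h3) h4 (h5.congr fun k hk => (hπ' k (by omega)).symm)

end Measure

/-! ### Reset strategies -/

section Reset

variable {Q : Type*} {σ : G.adversarial.Strategy .two} {M : MealyMachine Q V (Option V)}

theorem adversarial_owner_eq_two {v : V} :
    G.adversarial.owner v = some .two ↔ G.owner v ≠ some .one := by
  simp only [adversarial]
  rcases G.owner v with _ | _ | _ <;> simp

/-- The empty `ρ` is a witness, as a one-vertex word contains no move to check. Hence a reset is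
always safe. -/
theorem reachableTransition_init (v : V) : G.ReachableTransition σ M M.init v := by
  refine ⟨[], List.isChain_singleton _, fun ρ a b h => ?_, rfl⟩
  have := h.length_le
  simp at this

theorem ReachableTransition.exists_out {q : Q} {v : V} (hM : σ.DefinedBy M)
    (h : G.ReachableTransition σ M q v) (ho : G.owner v ≠ some .one) :
    ∃ v', M.out q v = some v' ∧ G.edge v v' := by
  obtain ⟨ρ, hρ, -, rfl⟩ := h
  have ho := adversarial_owner_eq_two.2 ho
  exact ⟨_, hM ρ v hρ ho, σ.legal ρ v hρ ho⟩

/-- The invariant behind reset strategies: extending the witnessing prefix by a move that `M` allows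
keeps it consistent, so no reset is triggered. -/
theorem ReachableTransition.step {q : Q} {v v' : V} (hM : σ.DefinedBy M)
    (h : G.ReachableTransition σ M q v) (he : G.edge v v')
    (ho : G.owner v ≠ some .one → M.out q v = some v') :
    G.ReachableTransition σ M (M.trans q v) v' := by
  obtain ⟨ρ, hρ, hc, rfl⟩ := h
  refine ⟨ρ ++ [v], ?_, fun ρ' a b hp ha => ?_, M.run_append_singleton ρ v⟩
  · refine List.isChain_append.2 ⟨hρ, List.isChain_singleton _, fun x hx y hy => ?_⟩
    simp only [List.getLast?_append, List.getLast?_singleton, Option.some_or, Option.mem_def,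
      Option.some.injEq, List.head?_cons] at hx hy
    subst hx hy
    exact he
  · rcases List.prefix_concat_iff.1 hp with hp | hp
    · have e : (ρ' ++ [a]) ++ [b] = (ρ ++ [v]) ++ [v'] := by simpa using hp
      obtain ⟨e', rfl⟩ := List.append_singleton_inj.1 e
      obtain ⟨rfl, rfl⟩ := List.append_singleton_inj.1 e'
      exact Option.some.inj ((ho (adversarial_owner_eq_two.1 ha)).symm.trans (hM _ _ hρ ha))
    · exact hc ρ' a b hp ha

open Classical in
/-- The state of `M` which the reset machine uses in state `q` on reading `v`. -/
noncomputable def resetState (G : StochasticGame V) (σ : G.adversarial.Strategy .two)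
    (M : MealyMachine Q V (Option V)) (q : Q) (v : V) : Q :=
  if G.ReachableTransition σ M q v then q else M.init

theorem reachableTransition_resetState (q : Q) (v : V) :
    G.ReachableTransition σ M (G.resetState σ M q v) v := by
  unfold resetState
  split_ifs with h
  · exact h
  · exact reachableTransition_init v

theorem resetState_eq {q : Q} {v : V} (h : G.ReachableTransition σ M q v) :
    G.resetState σ M q v = q := if_pos h

theorem resetMachine_trans (q : Q) (v : V) :
    (G.resetMachine σ M).trans q v = M.trans (G.resetState σ M q v) v := by
  unfold resetState resetMachine
  dsimp only
  split_ifs <;> rfl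

theorem resetMachine_out (q : Q) {v : V} (hv : G.owner v = some .two) :
    (G.resetMachine σ M).out q v = M.out (G.resetState σ M q v) v := by
  unfold resetState resetMachine
  dsimp only
  rw [if_pos hv]
  split_ifs <;> rfl

/-- From the reachable transitions of a winning machine, bad windows occur within a bounded number
of steps. -/
theorem exists_bound_of_reachableTransition [Finite V] [Finite Q] {ℓ : ℕ}
    (hσ : ∀ v, σ.WinsFrom (G.adversarial.compl (G.fwmp ℓ)) v) (hM : σ.DefinedBy M) :
    ∃ N, ∀ (q : Q) (π : ℕ → V), G.ReachableTransition σ M q (π 0) →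
      (∀ j < N, G.edge (π j) (π (j + 1)) ∧ (G.owner (π j) ≠ some .one →
        M.out ((history π j).foldl M.trans q) (π j) = some (π (j + 1)))) →
      ∃ i, i + ℓ ≤ N ∧ G.BadWindow ℓ π i := by
  let C : Q → ℕ → (ℕ → V) → Prop := fun q n π => G.ReachableTransition σ M q (π 0) ∧
    ∀ j < n, G.edge (π j) (π (j + 1)) ∧ (G.owner (π j) ≠ some .one →
      M.out ((history π j).foldl M.trans q) (π j) = some (π (j + 1)))
  have hN : ∀ q, ∃ N, ∀ π, C q N π → ∃ i, i + ℓ ≤ N ∧ G.BadWindow ℓ π i := by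
    intro q
    refine G.exists_bound_badWindow ℓ (C q) (fun n π hn => ⟨hn.1, fun j hj => hn.2 j (by omega)⟩)
      (fun n π π' he hn => ⟨he 0 (by omega) ▸ hn.1, fun j hj => ?_⟩) fun π hπ => ?_
    · rw [← history_congr fun k hk => he k (by omega), ← he j (by omega), ← he (j + 1) (by omega)]
      exact hn.2 j hj
    · obtain ⟨ρ, hρ, hc, rfl⟩ := (hπ 0).1
      have hlen : prepend ρ π ρ.length = π 0 := prepend_length_add ρ π 0
      have hhist : history (prepend ρ π) (ρ.length + 1) = ρ ++ [π 0] := by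
        rw [history_succ, history_prepend, hlen]
      have hplay : prepend ρ π ∈ G.plays := by
        intro k
        rcases lt_or_ge k ρ.length with hk | hk
        · refine isChain_history_succ.1 (?_ : (history (prepend ρ π) (ρ.length + 1)).IsChain _)
            k hk
          rw [hhist]
          exact hρ
        · obtain ⟨j, rfl⟩ := Nat.exists_eq_add_of_le hk
          rw [add_assoc, prepend_length_add, prepend_length_add]
          exact ((hπ (j + 1)).2 j (by omega)).1
      have hcons : σ.Consistent (prepend ρ π) := by
        intro k ho
        rcases lt_or_ge k ρ.length with hk | hk
        · refine hc _ _ _ ?_ ho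
          rw [← hhist]
          have e : history (prepend ρ π) k ++ [prepend ρ π k, prepend ρ π (k + 1)] =
              history (prepend ρ π) (k + 2) := by
            simp [history_succ]
          rw [e]
          exact history_prefix _ (by omega)
        · obtain ⟨j, rfl⟩ := Nat.exists_eq_add_of_le hk
          have h1 := ((hπ (j + 1)).2 j (by omega)).2
          rw [prepend_length_add, adversarial_owner_eq_two] at ho
          have h2 := h1 ho
          have h3 := hM (history (prepend ρ π) (ρ.length + j)) (prepend ρ π (ρ.length + j)) (by
            rw [← history_succ]
            exact isChain_history_succ.2 fun k _ => hplay k) (by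
            rwa [prepend_length_add, adversarial_owner_eq_two])
          have h4 : M.run (history (prepend ρ π) (ρ.length + j)) =
              (history π j).foldl M.trans (M.run ρ) := by
            rw [history_prepend_add, MealyMachine.run, List.foldl_append]
            rfl
          rw [h4, prepend_length_add, h2] at h3
          rw [add_assoc, prepend_length_add, prepend_length_add]
          exact Option.some.inj h3
      obtain ⟨i, hi, hb⟩ := (mem_compl_fwmp.1 (hσ _ _ hplay rfl hcons)).2 ρ.length
      obtain ⟨j, rfl⟩ := Nat.exists_eq_add_of_le hi
      refine ⟨j, ?_⟩
      have := badWindow_shift.2 hb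
      simp only [prepend_length_add] at this
      exact this
  choose N hN using hN
  obtain ⟨N', hN'⟩ := Finite.exists_le N
  refine ⟨N', fun q π hq hπ => ?_⟩
  obtain ⟨i, hi, hb⟩ := hN q π ⟨hq, fun j hj => hπ j (hj.trans_le (hN' q))⟩
  exact ⟨i, hi.trans (hN' q), hb⟩

/-- The reset machine of a machine for a surely winning strategy in the adversarial game defines an
almost-surely winning strategy. -/
theorem exists_resetStrategy [Finite V] [MeasurableSpace V] [DiscreteMeasurableSpace V]
    [Finite Q] {ℓ : ℕ} (hσ : ∀ v, σ.WinsFrom (G.adversarial.compl (G.fwmp ℓ)) v)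
    (hM : σ.DefinedBy M) :
    ∃ τ : G.Strategy .two, τ.DefinedBy (G.resetMachine σ M) ∧
      ∀ v, τ.AlmostSureWinsFrom (G.compl (G.fwmp ℓ)) v := by
  set R := G.resetMachine σ M
  have hleg : ∀ ρ v, G.IsPath (ρ ++ [v]) → G.owner v = some .two →
      ∃ v', R.out (R.run ρ) v = some v' ∧ G.edge v v' := by
    intro ρ v _ hv
    rw [resetMachine_out _ hv]
    exact (reachableTransition_resetState _ v).exists_out hM (by simp [hv])
  refine ⟨.ofMachine R hleg, Strategy.ofMachine_definedBy R hleg, fun v ξ => ?_⟩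
  obtain ⟨N, hN⟩ := exists_bound_of_reachableTransition hσ hM
  obtain ⟨p, hp0, hp1, hp⟩ := G.exists_pos_le_prob
  refine outcomeMeasure_compl_fwmp (N := N) hp0 fun n x hx => ?_
  -- The favourable continuation: Player 1 follows `ξ`, while Player 2 and chance both follow `M`
  -- from the reset state. The default `v` is never used, since `M` has an output at reachable
  -- pairs.
  let f : List V → V → V := fun ρ v =>
    if G.owner v = some .one then ξ.toFun ρ v
    else (M.out (G.resetState σ M (R.run ρ) v) v).getD v
  have f_one : ∀ ρ v, G.owner v = some .one → f ρ v = ξ.toFun ρ v := by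
    intro ρ v hv
    exact if_pos hv
  have f_out : ∀ ρ v, G.owner v ≠ some .one →
      M.out (G.resetState σ M (R.run ρ) v) v = some (f ρ v) ∧ G.edge v (f ρ v) := by
    intro ρ v hv
    obtain ⟨v', h1, h2⟩ := (reachableTransition_resetState (σ := σ) (M := M) (R.run ρ)
      v).exists_out hM hv
    have : f ρ v = v' := by
      simp only [f]
      rw [if_neg hv, h1]
      rfl
    rw [this]
    exact ⟨h1, h2⟩
  obtain ⟨π, hπx, hπf⟩ := exists_continuation f x n N
  -- Proved by induction because `ξ` is legal only after paths.
  have hedge : ∀ m ≤ N, ∀ k < n + m, G.edge (π k) (π (k + 1)) := by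
    intro m
    induction m with
    | zero =>
      intro _ k hk
      rw [hπx k (by omega), hπx (k + 1) (by omega)]
      exact hx k (by omega)
    | succ m ih =>
      intro hm k hk
      have ih := ih (by omega)
      obtain hk | rfl : k < n + m ∨ k = n + m := by omega
      · exact ih k hk
      · rw [hπf m (by omega)]
        by_cases ho : G.owner (π (n + m)) = some .one
        · rw [f_one _ _ ho]
          refine ξ.legal _ _ ?_ ho
          rw [← history_succ]
          exact isChain_history_succ.2 ih
        · exact (f_out _ _ ho).2
  have hedge : ∀ k < N, G.edge (π (n + k)) (π (n + k + 1)) := fun k hk =>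
    hedge N le_rfl (n + k) (by omega)
  have hout : ∀ k < N, G.owner (π (n + k)) ≠ some .one →
      M.out (G.resetState σ M (R.run (history π (n + k))) (π (n + k))) (π (n + k)) =
        some (π (n + k + 1)) := by
    intro k hk ho
    rw [hπf k hk]
    exact (f_out _ _ ho).1
  refine ⟨π, hπx, fun k hk => ?_, ?_⟩
  · unfold nextDist
    split
    · rename_i ho
      exact hp ⟨_, ho⟩ _ (hedge k hk)
    · rename_i ho
      rw [hπf k hk, f_one _ _ ho, PMF.pure_apply_self]
      exact hp1
    · rename_i ho
      have : (Strategy.ofMachine R hleg).toFun (history π (n + k)) (π (n + k)) =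
          π (n + k + 1) := by
        change (R.out _ _).getD _ = _
        rw [resetMachine_out _ ho, hout k hk (by simp [ho])]
        rfl
      rw [this, PMF.pure_apply_self]
      exact hp1
  · set q := G.resetState σ M (R.run (history π n)) (π n)
    -- After a possible reset at position `n`, no reset occurs for `N` steps, so the reset machine
    -- runs as `M` does from `q`.
    have hstate : ∀ k ≤ N, G.resetState σ M (R.run (history π (n + k))) (π (n + k)) =
        (history (fun k => π (n + k)) k).foldl M.trans q := by
      intro k
      induction k with
      | zero => intro _; rfl
      | succ k ih =>
        intro hk
        have hr := (reachableTransition_resetState (σ := σ) (M := M)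
          (R.run (history π (n + k))) (π (n + k))).step hM (hedge k (by omega))
          (hout k (by omega))
        rw [← add_assoc, history_succ, R.run_append_singleton, resetMachine_trans,
          resetState_eq hr, ih (by omega), history_succ, List.foldl_append]
        rfl
    obtain ⟨i, hi, hb⟩ := hN q (fun k => π (n + k)) (reachableTransition_resetState _ _)
      fun k hk => ⟨hedge k hk, fun ho => by
        rw [← hstate k hk.le]
        exact hout k hk ho⟩
    exact ⟨n + i, by omega, by omega, badWindow_shift.1 hb⟩

end Reset

end StochasticGame

theorem mainTheorem4 {V : Type*} [Finite V] [MeasurableSpace V] [DiscreteMeasurableSpace V]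
    (G : StochasticGame V) (ℓ : ℕ) (hℓ : 1 ≤ ℓ) :
    -- the sure-almost-sure property
    G.HasSAS (G.fwmp ℓ) ∧
    -- if Player 2 wins everywhere in the adversarial game, one finite-memory strategy does so
    (G.adversarial.winningRegion .two (G.adversarial.compl (G.fwmp ℓ)) = Set.univ →
      ∃ σ : G.adversarial.Strategy .two,
        (∀ v, σ.WinsFrom (G.adversarial.compl (G.fwmp ℓ)) v) ∧ σ.memorySize ≠ ⊤) ∧
    -- for every strategy that does so
    (∀ σ : G.adversarial.Strategy .two,
      (∀ v, σ.WinsFrom (G.adversarial.compl (G.fwmp ℓ)) v) →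
      -- the reset machine of every finite machine for it defines an almost-sure winning strategy
      (∀ (n : ℕ) (M : MealyMachine (Fin n) V (Option V)), σ.DefinedBy M →
        ∃ τ : G.Strategy .two, τ.DefinedBy (G.resetMachine σ M) ∧
          ∀ v, τ.AlmostSureWinsFrom (G.compl (G.fwmp ℓ)) v) ∧
      -- and some such reset strategy has no larger memory size
      (σ.memorySize ≠ ⊤ →
        ∃ (n : ℕ) (M : MealyMachine (Fin n) V (Option V)) (τ : G.Strategy .two),
          σ.DefinedBy M ∧ τ.DefinedBy (G.resetMachine σ M) ∧
          (∀ v, τ.AlmostSureWinsFrom (G.compl (G.fwmp ℓ)) v) ∧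
          τ.memorySize ≤ σ.memorySize)) := by
  have fin : G.adversarial.winningRegion .two (G.adversarial.compl (G.fwmp ℓ)) = Set.univ →
      ∃ σ : G.adversarial.Strategy .two,
        (∀ v, σ.WinsFrom (G.adversarial.compl (G.fwmp ℓ)) v) ∧ σ.memorySize ≠ ⊤ :=
    fun h => StochasticGame.exists_finite_memory_winsFrom (G := G.adversarial) ℓ h
  refine ⟨⟨fun π hπ => hπ.1, G.measurableSet_fwmp ℓ, G.fwmp_prefixIndependent ℓ, fun h => ?_⟩,
    fin, fun σ hσ => ⟨fun n M hM => StochasticGame.exists_resetStrategy hσ hM, fun h => ?_⟩⟩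
  · obtain ⟨σ, hσ, hm⟩ := fin h
    obtain ⟨n, M, hM, -⟩ := StochasticGame.Strategy.exists_definedBy_of_memorySize_ne_top hm
    obtain ⟨τ, -, hτ⟩ := StochasticGame.exists_resetStrategy hσ hM
    exact Set.eq_univ_of_forall fun v => ⟨τ, hτ v⟩
  -- A machine `M` of minimal size is taken; its reset machine has the same `n` states.
  · obtain ⟨n, M, hM, hn⟩ := StochasticGame.Strategy.exists_definedBy_of_memorySize_ne_top h
    obtain ⟨τ, hR, hτ⟩ := StochasticGame.exists_resetStrategy hσ hM
    exact ⟨n, M, τ, hM, hR, hτ, hn ▸ τ.memorySize_le hR⟩
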